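/- Let $n\ge 3$ be an integer, $m=\frac{n-2}{n+2}$, $\lambda>0$, $\beta>\beta_1:=\frac{1}{n-2-nm}=\frac{1}{2m}$ and $\alpha=\frac{2\beta+1}{1-m}$. Let $$C_\ast=\frac{2m(n-2-nm)}{1-m}>0,\qquad A(\beta)=n-2-(n+2)m+2\beta(n-2-nm),$$ $$\gamma_1=\frac{1}{2(1-m)}\left(A(\beta)-\sqrt{A(\beta)^2-8(n-2-nm)(1-m)}\right),$$ so that $\gamma_1>0$ is the smaller of the two real roots of $\gamma^2-\beta(n-2)\gamma+(n-2)=0$. Let $g_\lambda$ be a radially symmetric classical ($C^2$) solution of $$\Delta g^m+\alpha g+\beta\,x\cdot\nabla g=0,\quad g>0,\qquad\text{in }\mathbb{R}^n\setminus\{0\},$$ with $$\lim_{|x|\to 0}|x|^{\alpha/\beta}g_\lambda(x)=\lambda^{-\frac{1}{(1-m)\beta}}.$$ Then there is a constant $B>0$ such that $$g_\lambda(x)=\left(\frac{C_\ast}{|x|^2}\right)^{\frac{1}{1-m}}\left(1+B|x|^{-\gamma_1}+o(|x|^{-\gamma_1})\right)\qquad\text{as }|x|\to\infty.$$ -/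

import Mathlib

open Real Set Filter Topology Asymptotics

/-- The elliptic equation `Δ v^m + α v + β x · ∇v = 0`, `v > 0`, in `ℝⁿ ∖ {0}`, for a classical
(twice continuously differentiable) `v`.  The value of `v` at the origin plays no role. -/
structure IsSingularSolution (n : ℕ) (m α β : ℝ) (v : EuclideanSpace ℝ (Fin n) → ℝ) : Prop where
  contDiffOn : ContDiffOn ℝ 2 v {0}ᶜ
  pos : ∀ x, x ≠ 0 → 0 < v x
  eqn : ∀ x, x ≠ 0 →
    Laplacian.laplacian (fun y => v y ^ m) x + α * v x + β * inner ℝ x (gradient v x) = 0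

/-- Radial symmetry of a function on `ℝⁿ ∖ {0}`. -/
def IsRadial (n : ℕ) (v : EuclideanSpace ℝ (Fin n) → ℝ) : Prop :=
  ∀ x y, x ≠ 0 → y ≠ 0 → ‖x‖ = ‖y‖ → v x = v y

/-- The blow-up rate `|x|^(α/β) v(x) → lam^(-ρ₁/((1-m)β))` as `x → 0`. -/
def HasBlowUpRate (n : ℕ) (m ρ₁ α β lam : ℝ) (v : EuclideanSpace ℝ (Fin n) → ℝ) : Prop :=
  Tendsto (fun x => ‖x‖ ^ (α / β) * v x) (𝓝[≠] 0) (𝓝 (lam ^ (-ρ₁ / ((1 - m) * β))))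

/-- `β₁ = ρ₁ / (n - 2 - n m)`. -/
noncomputable def betaOne (n : ℕ) (m ρ₁ : ℝ) : ℝ := ρ₁ / ((n : ℝ) - 2 - n * m)

/-- `C_* = 2 m (n - 2 - n m) / ((1 - m) ρ₁)`. -/
noncomputable def cStar (n : ℕ) (m ρ₁ : ℝ) : ℝ :=
  2 * m * ((n : ℝ) - 2 - n * m) / ((1 - m) * ρ₁)

/-- `A(β) = n - 2 - (n + 2) m + 2 β (n - 2 - n m) / ρ₁`. -/
noncomputable def coeffA (n : ℕ) (m ρ₁ β : ℝ) : ℝ :=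
  (n : ℝ) - 2 - (n + 2) * m + 2 * β * (n - 2 - n * m) / ρ₁

/-- The smaller root `γ₁ = (A(β) - √(A(β)² - 8 (n - 2 - n m)(1 - m))) / (2 (1 - m))` of
`γ² - (A(β)/(1-m)) γ + 2 (n - 2 - n m)/(1 - m) = 0`. -/
noncomputable def gammaOne (n : ℕ) (m ρ₁ β : ℝ) : ℝ :=
  1 / (2 * (1 - m)) *
    (coeffA n m ρ₁ β - √(coeffA n m ρ₁ β ^ 2 - 8 * ((n : ℝ) - 2 - n * m) * (1 - m)))

/-! With `N = n - 2`, `b = β N`, `s = log r` and `X = exp q = r² g^(1-m) / C_*`, the radial equation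
becomes the autonomous system `q' = y`, `y' = -(N/4) y² - b X y - N (X - 1)`. At its equilibrium `X
= 1`, `y = 0` the decay exponents are the roots `γ < γ'` of `z² - b z + N`, and `β > β₁` says
exactly that this polynomial is negative at `2`, so `γ < 2 < γ'`.

The blow-up at the origin places the orbit in the region `X > 1`, `-2 (X - 1) < y < 0` at some time,
and `invariant` keeps it there. Hence the rate `r = -y / (X - 1)` stays below `2`, which excludes
the fast mode `γ'`. It obeys `r' = (r - γ)(r - γ') + O(X - 1)`, so `r → γ` exponentially
(`exists_lyapunov_decay`). Then `log (X - 1) + γ s` has an integrable derivative and converges;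
exponentiating its limit gives a positive coefficient. Taking the power `1/(1-m)` of `X` yields the
expansion of `g`. -/

/-! ### Scalar differential inequalities. -/

/-- A function with `-M h ≤ h'` on `[a, t)` that is positive at `a` is positive at `t`. -/
lemma pos_of_neg_mul_le_deriv {h h' : ℝ → ℝ} {a t M : ℝ} (hat : a ≤ t)
    (hd : ∀ s, HasDerivAt h (h' s) s) (hb : ∀ s ∈ Ico a t, -(M * h s) ≤ h' s) (ha : 0 < h a) :
    0 < h t := by
  have hD : ∀ s, HasDerivAt (fun s => h s * exp (M * s))
      (h' s * exp (M * s) + h s * (exp (M * s) * M)) s := fun s =>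
    (hd s).mul (by simpa using ((hasDerivAt_id s).const_mul M).exp)
  have hmono : MonotoneOn (fun s => h s * exp (M * s)) (Icc a t) := by
    refine monotoneOn_of_deriv_nonneg (convex_Icc a t)
      (fun s _ => (hD s).continuousAt.continuousWithinAt)
      (fun s _ => (hD s).differentiableAt.differentiableWithinAt) fun s hs => ?_
    rw [interior_Icc] at hs
    rw [(hD s).deriv]
    have := mul_nonneg (by linarith [hb s ⟨hs.1.le, hs.2⟩] : 0 ≤ h' s + M * h s)
      (exp_pos (M * s)).le
    linarith
  have h1 := hmono (left_mem_Icc.2 hat) (right_mem_Icc.2 hat) hat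
  have h2 : 0 < h t * exp (M * t) := lt_of_lt_of_le (mul_pos ha (exp_pos _)) h1
  exact pos_of_mul_pos_left h2 (exp_pos _).le

/-- Grönwall's inequality for a linear decay rate on a half line. -/
lemma le_mul_exp_of_deriv_le {h h' : ℝ → ℝ} {a k : ℝ}
    (hd : ∀ s, a ≤ s → HasDerivAt h (h' s) s) (hb : ∀ s, a ≤ s → h' s ≤ -(k * h s))
    {s : ℝ} (hs : a ≤ s) : h s ≤ h a * exp (-(k * (s - a))) := by
  have hD : ∀ s, a ≤ s → HasDerivAt (fun s => h s * exp (k * s))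
      (h' s * exp (k * s) + h s * (exp (k * s) * k)) s := fun s hs =>
    (hd s hs).mul (by simpa using ((hasDerivAt_id s).const_mul k).exp)
  have hanti : AntitoneOn (fun s => h s * exp (k * s)) (Ici a) := by
    refine antitoneOn_of_deriv_nonpos (convex_Ici a)
      (fun s hs => (hD s hs).continuousAt.continuousWithinAt)
      (fun s hs => (hD s (interior_subset hs)).differentiableAt.differentiableWithinAt)
      fun s hs => ?_
    have hs := interior_subset hs
    rw [(hD s hs).deriv]
    have := mul_nonneg (by linarith [hb s hs] : 0 ≤ -(k * h s) - h' s) (exp_pos (k * s)).le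
    linarith
  have h1 : h s * exp (k * s) ≤ h a * exp (k * a) := hanti self_mem_Ici hs hs
  have h2 : exp (-(k * (s - a))) = exp (k * a) * exp (-(k * s)) := by
    rw [← exp_add]; ring_nf
  have h3 : h s = h s * exp (k * s) * exp (-(k * s)) := by
    rw [mul_assoc, ← exp_add]; simp
  rw [h2, h3, ← mul_assoc]
  exact mul_le_mul_of_nonneg_right h1 (exp_pos _).le

/-- A function whose derivative decays exponentially converges at infinity. -/
lemma exists_tendsto_of_abs_deriv_le_exp {h h' : ℝ → ℝ} {a k A : ℝ} (hk : 0 < k)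
    (hd : ∀ s, a ≤ s → HasDerivAt h (h' s) s) (hc : ContinuousOn h' (Ici a))
    (hb : ∀ s, a ≤ s → |h' s| ≤ A * exp (-(k * (s - a)))) :
    ∃ l, Tendsto h atTop (𝓝 l) := by
  refine ⟨_, MeasureTheory.tendsto_limUnder_of_hasDerivAt_of_integrableOn_Ioi (a := a)
    (fun s hs => hd s (le_of_lt hs)) ?_⟩
  have hint : MeasureTheory.IntegrableOn (fun s => A * exp (k * a) * exp (-k * s)) (Ioi a) :=
    (exp_neg_integrableOn_Ioi a hk).const_mul _
  refine hint.mono' ((hc.mono Ioi_subset_Ici_self).aestronglyMeasurable measurableSet_Ioi) ?_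
  refine (MeasureTheory.ae_restrict_mem measurableSet_Ioi).mono fun s hs => ?_
  have := hb s (le_of_lt hs)
  rw [Real.norm_eq_abs, mul_assoc, ← exp_add]
  convert this using 3
  ring

/-! ### The autonomous system and its invariant region. -/

/-- The logarithmic autonomous system satisfied by `q = log (r² g^(1-m) / C)` in `s = log r`. -/
structure IsLogProfile (N b : ℝ) (q y : ℝ → ℝ) : Prop where
  deriv_q : ∀ s, HasDerivAt q (y s) s
  deriv_y : ∀ s, HasDerivAt y
    (-(N / 4) * y s ^ 2 - b * exp (q s) * y s - N * (exp (q s) - 1)) s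

namespace IsLogProfile

variable {N b : ℝ} {q y : ℝ → ℝ}

lemma deriv_exp (h : IsLogProfile N b q y) (s : ℝ) :
    HasDerivAt (fun s => exp (q s) - 1) (exp (q s) * y s) s :=
  (h.deriv_q s).exp.sub_const 1

lemma deriv_barrier (h : IsLogProfile N b q y) (s : ℝ) :
    HasDerivAt (fun s => y s + 2 * (exp (q s) - 1))
    (-(N / 4) * y s ^ 2 - b * exp (q s) * y s - N * (exp (q s) - 1) +
      2 * (exp (q s) * y s)) s :=
  (h.deriv_y s).add ((h.deriv_exp s).const_mul 2)

/-- Since `q + κ s` converges, `X → ∞` at `-∞`, and the mean value theorem on a unit interval gives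
a time with `|y + κ| < κ/2`. Once `X - 1 > κ`, this forces `-2 (X - 1) < y < 0`. -/
lemma exists_start (h : IsLogProfile N b q y) {κ l : ℝ} (hκ : 0 < κ)
    (hl : Tendsto (fun s => q s + κ * s) atBot (𝓝 l)) :
    ∃ s, 0 < exp (q s) - 1 ∧ 0 < y s + 2 * (exp (q s) - 1) ∧ y s < 0 := by
  have hq : Tendsto q atBot atTop := by
    have h1 : Tendsto (fun s : ℝ => -(κ * s)) atBot atTop :=
      tendsto_neg_atBot_atTop.comp (tendsto_id.const_mul_atBot hκ)
    refine (hl.add_atTop h1).congr fun s => ?_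
    ring
  have hX := tendsto_exp_atTop.comp hq
  obtain ⟨S1, hS1⟩ := eventually_atBot.1 (hX.eventually_gt_atTop (1 + κ))
  have hball := hl.eventually (Metric.ball_mem_nhds l (half_pos (half_pos hκ)))
  obtain ⟨S2, hS2⟩ := eventually_atBot.1 hball
  set S := min S1 S2
  have hd : ∀ s, HasDerivAt (fun s => q s + κ * s) (y s + κ) s := fun s => by
    simpa using (h.deriv_q s).fun_add ((hasDerivAt_id s).const_mul κ)
  obtain ⟨t, ht, hty⟩ := exists_hasDerivAt_eq_slope (fun s => q s + κ * s) (fun s => y s + κ)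
    (by linarith : S - 1 < S) (fun s _ => (hd s).continuousAt.continuousWithinAt)
    (fun s _ => hd s)
  have e1 := hS2 S (min_le_right _ _)
  have e2 := hS2 (S - 1) (by linarith [min_le_right S1 S2])
  have e3 := hS1 t (ht.2.le.trans (min_le_left _ _))
  simp only [Real.dist_eq, abs_lt, Function.comp] at e1 e2 e3
  have hty' : y t + κ = (q S + κ * S) - (q (S - 1) + κ * (S - 1)) := by
    rw [hty]; simp
  exact ⟨t, by linarith, by linarith, by linarith⟩

/-- The region `1 < X`, `-2 (X - 1) < y < 0` is positively invariant. -/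
lemma invariant (h : IsLogProfile N b q y) (hN : 0 < N) (hb : N + 4 < 2 * b) {a : ℝ}
    (h1 : 0 < exp (q a) - 1) (h2 : 0 < y a + 2 * (exp (q a) - 1)) (h3 : y a < 0)
    {s : ℝ} (hs : a ≤ s) :
    0 < exp (q s) - 1 ∧ 0 < y s + 2 * (exp (q s) - 1) ∧ y s < 0 := by
  -- `F` is the smallest of the three margins, and `t` below is its first nonpositive time. Each
  -- margin `h` satisfies `h' ≥ -M h` before `t`, so none can vanish at `t`; this also covers exit
  -- through the equilibrium corner.
  set F : ℝ → ℝ := fun s =>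
    min (exp (q s) - 1) (min (y s + 2 * (exp (q s) - 1)) (-y s)) with hF
  have hFpos : ∀ s, 0 < F s ↔
      0 < exp (q s) - 1 ∧ 0 < y s + 2 * (exp (q s) - 1) ∧ y s < 0 := fun s => by
    simp [hF]
  rw [← hFpos]
  by_contra hneg
  have hq : Continuous q := continuous_iff_continuousAt.2 fun s => (h.deriv_q s).continuousAt
  have hy : Continuous y := continuous_iff_continuousAt.2 fun s => (h.deriv_y s).continuousAt
  have hFc : Continuous F := by fun_prop
  have hcl : IsClosed {t | a ≤ t ∧ F t ≤ 0} :=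
    (isClosed_le continuous_const continuous_id).inter (isClosed_le hFc continuous_const)
  have hbdd : BddBelow {t | a ≤ t ∧ F t ≤ 0} := ⟨a, fun t ht => ht.1⟩
  obtain ⟨hat, hFt⟩ := hcl.csInf_mem ⟨s, hs, not_lt.1 hneg⟩ hbdd
  set t := sInf {t | a ≤ t ∧ F t ≤ 0}
  have hlt : ∀ u ∈ Ico a t,
      0 < exp (q u) - 1 ∧ 0 < y u + 2 * (exp (q u) - 1) ∧ y u < 0 := fun u hu => by
    rw [← hFpos]
    by_contra hu'
    exact absurd (csInf_le hbdd ⟨hu.1, not_lt.1 hu'⟩) (not_le.2 hu.2)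
  -- `X` decreases while `y < 0`; this bound makes the constants `M` uniform.
  have hXle : ∀ u ∈ Ico a t, exp (q u) ≤ exp (q a) := fun u hu => by
    have hanti : AntitoneOn (fun s => exp (q s) - 1) (Icc a u) := by
      refine antitoneOn_of_deriv_nonpos (convex_Icc a u)
        (fun s _ => (h.deriv_exp s).continuousAt.continuousWithinAt)
        (fun s _ => (h.deriv_exp s).differentiableAt.differentiableWithinAt) fun s hs => ?_
      rw [interior_Icc] at hs
      rw [(h.deriv_exp s).deriv]
      exact mul_nonpos_of_nonneg_of_nonpos (exp_pos _).le
        (hlt s ⟨hs.1.le, hs.2.trans hu.2⟩).2.2.le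
    have := hanti (left_mem_Icc.2 hu.1) (right_mem_Icc.2 hu.1) hu.1
    simp only at this
    linarith
  refine absurd ((hFpos t).2 ⟨?_, ?_, ?_⟩) (not_lt.2 hFt)
  · refine pos_of_neg_mul_le_deriv (h := fun s => exp (q s) - 1) (M := 2 * exp (q a)) hat
      h.deriv_exp (fun u hu => ?_) h1
    obtain ⟨i1, i2, i3⟩ := hlt u hu
    have := hXle u hu
    nlinarith [mul_pos (exp_pos (q u)) i2, mul_nonneg (sub_nonneg.2 this) i1.le]
  · refine pos_of_neg_mul_le_deriv (h := fun s => y s + 2 * (exp (q s) - 1))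
      (M := N / 2 * exp (q a) + (b - 2) * exp (q a)) hat
      h.deriv_barrier (fun u hu => ?_) h2
    obtain ⟨i1, i2, i3⟩ := hlt u hu
    have i4 := hXle u hu
    set X := exp (q u)
    set J := y u + 2 * (X - 1) with hJ
    have hyJ : y u = J - 2 * (X - 1) := by rw [hJ]; ring
    rw [hyJ]
    have i5 : J < 2 * (X - 1) := by linarith
    have j1 : 0 ≤ J * (exp (q a) - X) := mul_nonneg i2.le (by linarith)
    have j2 : 0 ≤ J * (2 * (X - 1) - J) := mul_nonneg i2.le (by linarith)
    -- This is the derivative of the barrier `J` on `J = 0`; its sign is where `N + 4 < 2 b` enters.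
    have j3 : 0 ≤ X * (X - 1) * (2 * b - 4 - N) :=
      mul_nonneg (mul_nonneg (by linarith) i1.le) (by linarith)
    have j4 : 0 ≤ (N / 2 + (b - 2)) * (J * (exp (q a) - X)) := mul_nonneg (by linarith) j1
    have j5 : 0 ≤ N / 4 * (J * (2 * (X - 1) - J)) := mul_nonneg (by linarith) j2
    have j6 : 0 ≤ N * (J * (X - 1)) := mul_nonneg hN.le (mul_nonneg i2.le i1.le)
    have j7 : 0 ≤ N * J := mul_nonneg hN.le i2.le
    linarith
  · rw [← neg_pos]
    refine pos_of_neg_mul_le_deriv (h := fun s => -y s) (M := b * exp (q a)) hat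
      (fun s => (h.deriv_y s).neg) (fun u hu => ?_) (neg_pos.2 h3)
    obtain ⟨i1, i2, i3⟩ := hlt u hu
    have i4 := hXle u hu
    nlinarith [mul_nonneg (mul_nonneg (by linarith : 0 ≤ b) (sub_nonneg.2 i4)) (neg_pos.2 i3).le,
      mul_nonneg hN.le (sq_nonneg (y u)), mul_pos hN i1]

end IsLogProfile

/-! ### Convergence of the decay rate to the slow mode. -/

namespace IsLogProfile

variable {N b : ℝ} {q y : ℝ → ℝ}

/-- The decay rate `-y / (X - 1)` satisfies a perturbed Riccati equation. -/
lemma deriv_rate (h : IsLogProfile N b q y) {s : ℝ} (hs : 0 < exp (q s) - 1) :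
    HasDerivAt (fun s => -y s / (exp (q s) - 1))
      ((-y s / (exp (q s) - 1)) ^ 2 - b * (-y s / (exp (q s) - 1)) + N + (exp (q s) - 1) *
        ((N / 4 + 1) * (-y s / (exp (q s) - 1)) ^ 2 - b * (-y s / (exp (q s) - 1)))) s := by
  refine ((h.deriv_y s).fun_neg.fun_div (h.deriv_exp s) hs.ne').congr_deriv ?_
  field_simp
  ring

/-- In the invariant region the decay rate is bounded below by a positive constant. -/
lemma exists_le_rate (h : IsLogProfile N b q y) (hN : 0 < N) (hb : 0 < b) {a : ℝ}
    (hr : ∀ s, a ≤ s →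
      0 < exp (q s) - 1 ∧ 0 < y s + 2 * (exp (q s) - 1) ∧ y s < 0) :
    ∃ c > 0, ∀ s, a ≤ s → c ≤ -y s / (exp (q s) - 1) := by
  have hanti : AntitoneOn (fun s => exp (q s) - 1) (Ici a) := by
    refine antitoneOn_of_deriv_nonpos (convex_Ici a)
      (fun s _ => (h.deriv_exp s).continuousAt.continuousWithinAt)
      (fun s _ => (h.deriv_exp s).differentiableAt.differentiableWithinAt) fun s hs => ?_
    rw [(h.deriv_exp s).deriv]
    exact mul_nonpos_of_nonneg_of_nonpos (exp_pos _).le (hr s (interior_subset hs)).2.2.le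
  set k := b * exp (q a)
  have hk : 0 < k := mul_pos hb (exp_pos _)
  set r : ℝ → ℝ := fun s => -y s / (exp (q s) - 1) with hrdef
  have hra : 0 < r a := div_pos (neg_pos.2 (hr a le_rfl).2.2) (hr a le_rfl).1
  -- Dropping the squares in the Riccati equation and using `X ≤ X(a)` leaves `r' ≥ N - k r`, whose
  -- equilibrium is `N / k`.
  refine ⟨min (r a) (N / k), lt_min hra (div_pos hN hk), fun s hs => ?_⟩
  have key := le_mul_exp_of_deriv_le (h := fun s => N / k - r s) (k := k)
    (fun s hs => (h.deriv_rate (hr s hs).1).const_sub (N / k)) (fun s hs => by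
      obtain ⟨i1, i2, i3⟩ := hr s hs
      have hX : exp (q s) - 1 ≤ exp (q a) - 1 := hanti self_mem_Ici hs hs
      change -(r s ^ 2 - b * r s + N + (exp (q s) - 1) *
        ((N / 4 + 1) * r s ^ 2 - b * r s)) ≤ -(k * (N / k - r s))
      have hrs : 0 < r s := div_pos (neg_pos.2 i3) i1
      rw [mul_sub k, mul_div_cancel₀ _ hk.ne']
      have j1 : 0 ≤ b * r s * (exp (q a) - exp (q s)) :=
        mul_nonneg (mul_pos hb hrs).le (by linarith)
      have j2 : 0 ≤ (exp (q s) - 1) * ((N / 4 + 1) * r s ^ 2) := by positivity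
      have j3 : k * r s = b * r s * exp (q a) := by simp only [k]; ring
      nlinarith [sq_nonneg (r s)]) hs
  have he : exp (-(k * (s - a))) ≤ 1 := exp_le_one_iff.2 (by
    have := mul_nonneg hk.le (sub_nonneg.2 hs); linarith)
  change N / k - r s ≤ (N / k - r a) * exp (-(k * (s - a))) at key
  rcases le_total (r a) (N / k) with h' | h'
  · have := mul_le_of_le_one_right (sub_nonneg.2 h') he
    exact (min_le_left _ _).trans (by linarith)
  · have := mul_nonneg (sub_nonneg.2 h') (exp_pos (-(k * (s - a)))).le
    exact (min_le_right _ _).trans (by linarith)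

/-- Exponential decay of `(rate - γ)² + K (X - 1)`, with `γ` the smaller characteristic root. -/
lemma exists_lyapunov_decay (h : IsLogProfile N b q y) {γ γ' a : ℝ} (hγ : 0 < γ) (hγ2 : γ < 2)
    (hγ' : 2 < γ') (hsum : γ + γ' = b) (hprod : γ * γ' = N)
    (hr : ∀ s, a ≤ s →
      0 < exp (q s) - 1 ∧ 0 < y s + 2 * (exp (q s) - 1) ∧ y s < 0) :
    ∃ K > 0, ∃ k > 0, ∃ A, ∀ s, a ≤ s →
      (-y s / (exp (q s) - 1) - γ) ^ 2 + K * (exp (q s) - 1) ≤ A * exp (-(k * (s - a))) := by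
  have hN : 0 < N := hprod ▸ mul_pos hγ (by linarith)
  have hb : 0 < b := by linarith
  obtain ⟨c, hc, hcr⟩ := h.exists_le_rate hN hb hr
  set r : ℝ → ℝ := fun s => -y s / (exp (q s) - 1) with hrdef
  -- `M` bounds the perturbation for rates below `2`. In `K c = 4 M + 1`, the `4 M` absorbs the
  -- cross term and the `1` leaves a damping `X - 1`, of which `k K ≤ 1` uses at most all; `k ≤ 2
  -- (γ' - 2)` handles the square.
  set M := 4 * (N / 4 + 1) + 2 * b with hM
  have hMpos : 0 < M := by positivity
  set K := (4 * M + 1) / c with hK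
  have hKpos : 0 < K := by positivity
  set k := min (2 * (γ' - 2)) (1 / K) with hk
  refine ⟨K, hKpos, k, lt_min (by linarith) (by positivity),
    (r a - γ) ^ 2 + K * (exp (q a) - 1), fun s hs => ?_⟩
  have hVd : ∀ s, a ≤ s → HasDerivAt (fun s => (r s - γ) ^ 2 + K * (exp (q s) - 1))
      (2 * (r s - γ) * (r s ^ 2 - b * r s + N + (exp (q s) - 1) *
        ((N / 4 + 1) * r s ^ 2 - b * r s)) + K * (exp (q s) * y s)) s := fun s hs => by
    have := (((h.deriv_rate (hr s hs).1).sub_const γ).fun_pow 2).fun_add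
      ((h.deriv_exp s).const_mul K)
    refine this.congr_deriv ?_
    simp [hrdef]
  refine le_mul_exp_of_deriv_le (h := fun s => (r s - γ) ^ 2 + K * (exp (q s) - 1)) hVd
    (fun s hs => ?_) hs
  obtain ⟨i1, i2, i3⟩ := hr s hs
  have hrc : c ≤ r s := hcr s hs
  have hr2 : r s < 2 := by rw [hrdef, div_lt_iff₀ i1]; linarith
  have hy : y s = -(r s * (exp (q s) - 1)) := by rw [hrdef]; field_simp
  have hX : exp (q s) = (exp (q s) - 1) + 1 := by ring
  set D := exp (q s) - 1
  set ρ := r s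
  rw [hy, hX]
  have hρ : 0 < ρ := hc.trans_le hrc
  set E := (N / 4 + 1) * ρ ^ 2 - b * ρ with hE
  have hρ2 : ρ ^ 2 ≤ 4 := by nlinarith
  have hEM : |E| ≤ M := by
    have e1 : 0 ≤ (N / 4 + 1) * (4 - ρ ^ 2) := mul_nonneg (by positivity) (by linarith)
    have e2 : 0 ≤ b * (2 - ρ) := mul_nonneg hb.le (by linarith)
    have e3 : 0 ≤ (N / 4 + 1) * ρ ^ 2 := by positivity
    have e4 : 0 < b * ρ := mul_pos hb hρ
    rw [abs_le]; constructor <;> linarith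
  have hσ : |ρ - γ| ≤ 2 := abs_le.2 ⟨by linarith, by linarith⟩
  have t1 : (ρ - γ) * E ≤ 2 * M :=
    (le_abs_self _).trans (by rw [abs_mul]; exact mul_le_mul hσ hEM (abs_nonneg _) (by norm_num))
  have t2 : 2 * D * ((ρ - γ) * E) ≤ 2 * D * (2 * M) :=
    mul_le_mul_of_nonneg_left t1 (by linarith)
  have t3 : (4 * M + 1) * D ≤ K * ρ * D := by
    refine mul_le_mul_of_nonneg_right ?_ i1.le
    rw [hK, div_mul_eq_mul_div, le_div_iff₀ hc]
    exact mul_le_mul_of_nonneg_left hrc (by positivity)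
  have t4 : 0 ≤ K * ρ * D ^ 2 := by positivity
  have t5 : 0 ≤ (γ' - 2 + (2 - ρ) - k / 2) * (ρ - γ) ^ 2 :=
    mul_nonneg (by linarith [min_le_left (2 * (γ' - 2)) (1 / K)]) (sq_nonneg _)
  have t6 : k * K * D ≤ 1 * D := by
    refine mul_le_mul_of_nonneg_right ?_ i1.le
    calc k * K ≤ 1 / K * K := mul_le_mul_of_nonneg_right (min_le_right _ _) hKpos.le
      _ = 1 := by field_simp
  have t7 : ρ ^ 2 - b * ρ + N = (ρ - γ) * (ρ - γ') := by rw [← hsum, ← hprod]; ring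
  rw [t7]
  linarith

/-- Convergence of `e^(γ s) (X(s) - 1)` to a positive limit along the slow mode. -/
theorem exists_tendsto (h : IsLogProfile N b q y) {γ γ' κ l : ℝ} (hγ : 0 < γ) (hγ2 : γ < 2)
    (hγ' : 2 < γ') (hsum : γ + γ' = b) (hprod : γ * γ' = N) (hκ : 0 < κ)
    (hl : Tendsto (fun s => q s + κ * s) atBot (𝓝 l)) :
    ∃ B > 0, Tendsto (fun s => exp (γ * s) * (exp (q s) - 1)) atTop (𝓝 B) := by
  have hN : 0 < N := hprod ▸ mul_pos hγ (by linarith)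
  -- Expand `(2 - γ)(γ' - 2) > 0`.
  have hb : N + 4 < 2 * b := by nlinarith
  obtain ⟨a, h1, h2, h3⟩ := h.exists_start hκ hl
  have hr := fun s (hs : a ≤ s) => h.invariant hN hb h1 h2 h3 hs
  obtain ⟨K, hK, k, hk, A, hA⟩ := h.exists_lyapunov_decay hγ hγ2 hγ' hsum hprod hr
  have hd : ∀ s, a ≤ s → HasDerivAt (fun s => log (exp (q s) - 1) + γ * s)
      (exp (q s) * y s / (exp (q s) - 1) + γ) s := fun s hs => by
    simpa using ((h.deriv_exp s).log (hr s hs).1.ne').fun_add ((hasDerivAt_id s).const_mul γ)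
  have hq : Continuous q := continuous_iff_continuousAt.2 fun s => (h.deriv_q s).continuousAt
  have hy : Continuous y := continuous_iff_continuousAt.2 fun s => (h.deriv_y s).continuousAt
  obtain ⟨L, hL⟩ := exists_tendsto_of_abs_deriv_le_exp (half_pos hk)
    (A := √A + 2 * (A / K)) hd
    (ContinuousOn.add (ContinuousOn.div (by fun_prop) (by fun_prop) fun s hs => (hr s hs).1.ne')
      continuousOn_const) (fun s hs => by
      obtain ⟨i1, i2, i3⟩ := hr s hs
      have hAs := hA s hs
      set D := exp (q s) - 1 with hD
      set ρ := -y s / D with hρ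
      have hρ0 : 0 < ρ := div_pos (neg_pos.2 i3) i1
      have hρ2 : ρ < 2 := by rw [hρ, div_lt_iff₀ i1]; linarith
      -- Both terms are controlled by the Lyapunov function, `ρ - γ` only through its square, hence
      -- the rate `k / 2`.
      have e1 : exp (q s) * y s / D + γ = -(ρ - γ) - D * ρ := by
        have : exp (q s) = D + 1 := by rw [hD]; ring
        rw [this, hρ]; field_simp; ring
      have hKD : 0 < K * D := mul_pos hK i1
      set e := exp (-(k / 2 * (s - a))) with he
      have he2 : exp (-(k * (s - a))) = e ^ 2 := by
        rw [he, ← exp_nat_mul]; congr 1; push_cast; ring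
      have he1 : e ≤ 1 := exp_le_one_iff.2 (by
        have := mul_nonneg (half_pos hk).le (sub_nonneg.2 hs); linarith)
      have he0 : 0 < e := exp_pos _
      rw [he2] at hAs
      have hA0 : 0 < A := by
        by_contra hA'
        nlinarith [sq_nonneg (ρ - γ), mul_nonneg (neg_nonneg.2 (not_lt.1 hA')) (sq_nonneg e)]
      have e2 : |ρ - γ| ≤ √A * e := by
        refine abs_le_of_sq_le_sq ?_ (by positivity)
        rw [mul_pow, sq_sqrt hA0.le]; linarith
      have e3 : D ≤ A / K * e := by
        rw [div_mul_eq_mul_div, le_div_iff₀ hK]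
        nlinarith [sq_nonneg (ρ - γ), mul_nonneg hA0.le (mul_nonneg he0.le (sub_nonneg.2 he1))]
      rw [e1]
      calc |-(ρ - γ) - D * ρ| ≤ |-(ρ - γ)| + |D * ρ| := abs_sub _ _
        _ = |ρ - γ| + D * ρ := by rw [abs_neg, abs_of_pos (mul_pos i1 hρ0)]
        _ ≤ √A * e + 2 * (A / K * e) := by nlinarith
        _ = _ := by ring)
  refine ⟨exp L, exp_pos L, ((continuous_exp.tendsto L).comp hL).congr' ?_⟩
  filter_upwards [eventually_ge_atTop a] with s hs
  simp only [Function.comp]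
  rw [exp_add, exp_log (hr s hs).1, mul_comm]

end IsLogProfile

/-! ### Reduction of the elliptic equation to a radial ODE. -/

/-- The second derivative of a `C²` function along a line. -/
lemma ContDiffAt.iteratedFDeriv_two_eq_of_hasDerivAt {E : Type*} [NormedAddCommGroup E]
    [NormedSpace ℝ E] {u : E → ℝ} {x v : E} (hu : ContDiffAt ℝ 2 u x) {φ : ℝ → ℝ} {d : ℝ}
    (h1 : ∀ᶠ t in 𝓝 (0 : ℝ), HasDerivAt (fun t : ℝ => u (x + t • v)) (φ t) t)
    (h2 : HasDerivAt φ d 0) : iteratedFDeriv ℝ 2 u x ![v, v] = d := by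
  rw [iteratedFDeriv_two_apply]
  change fderiv ℝ (fderiv ℝ u) x v v = d
  have hline : ∀ t : ℝ, HasDerivAt (fun t : ℝ => x + t • v) v t := fun t => by
    simpa using ((hasDerivAt_id t).smul_const v).const_add x
  have hcont : Tendsto (fun t : ℝ => x + t • v) (𝓝 0) (𝓝 x) := by
    simpa using (hline 0).continuousAt.tendsto
  have hev : ∀ᶠ z in 𝓝 x, DifferentiableAt ℝ u z :=
    (hu.eventually (by simp)).mono fun z hz => hz.differentiableAt (by simp)
  have heq : φ =ᶠ[𝓝 0] fun t => fderiv ℝ u (x + t • v) v := by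
    filter_upwards [h1, hcont.eventually hev] with t ht hz
    exact ht.unique (hz.hasFDerivAt.comp_hasDerivAt t (hline t))
  have hf : DifferentiableAt ℝ (fderiv ℝ u) x :=
    (hu.fderiv_right (m := 1) (by norm_num)).differentiableAt (by simp)
  have hF : HasFDerivAt (fun z => fderiv ℝ u z v) ((fderiv ℝ (fderiv ℝ u) x).flip v) x := by
    simpa using hf.hasFDerivAt.clm_apply (hasFDerivAt_const v x)
  have hF' : HasFDerivAt (fun z => fderiv ℝ u z v) ((fderiv ℝ (fderiv ℝ u) x).flip v)
      (x + (0 : ℝ) • v) := by simpa using hF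
  have hc : HasDerivAt (fun t : ℝ => fderiv ℝ u (x + t • v) v)
      ((fderiv ℝ (fderiv ℝ u) x).flip v v) 0 :=
    HasFDerivAt.comp_hasDerivAt (l := fun z => fderiv ℝ u z v) (0 : ℝ) hF' (hline 0)
  exact (hc.congr_of_eventuallyEq heq).unique h2

/-- The Laplacian of a radial function, evaluated on the ray through a basis vector. -/
lemma laplacian_radial {n : ℕ} (i₀ : Fin n) {u : EuclideanSpace ℝ (Fin n) → ℝ} {U U' : ℝ → ℝ}
    {r d : ℝ} (hr : 0 < r) (hu : ContDiffAt ℝ 2 u (r • EuclideanSpace.single i₀ (1 : ℝ)))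
    (huU : ∀ x, x ≠ 0 → u x = U ‖x‖) (hU : ∀ s, 0 < s → HasDerivAt U (U' s) s)
    (hU' : HasDerivAt U' d r) :
    Laplacian.laplacian u (r • EuclideanSpace.single i₀ (1 : ℝ)) =
      d + (n - 1) * (U' r / r) := by
  rw [InnerProductSpace.laplacian_eq_iteratedFDeriv_orthonormalBasis u
    (EuclideanSpace.basisFun (Fin n) ℝ)]
  simp only [EuclideanSpace.basisFun_apply]
  set e : EuclideanSpace ℝ (Fin n) := EuclideanSpace.single i₀ (1 : ℝ) with he
  have hne : ‖e‖ = 1 := by simp [he]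
  have hdiag : iteratedFDeriv ℝ 2 u (r • e) ![e, e] = d := by
    refine hu.iteratedFDeriv_two_eq_of_hasDerivAt (φ := fun t => U' (r + t)) ?_ ?_
    · have hpos : ∀ᶠ t in 𝓝 (0 : ℝ), 0 < r + t :=
        (continuous_const.add continuous_id).continuousAt.eventually_const_lt (by simpa)
      filter_upwards [hpos.eventually_nhds] with t ht
      refine (((hU _ ht.self_of_nhds).comp_const_add r t)).congr_of_eventuallyEq ?_
      filter_upwards [ht] with t ht
      rw [← add_smul, huU, norm_smul, hne, mul_one, norm_of_nonneg ht.le]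
      rw [← norm_ne_zero_iff, norm_smul, hne, mul_one, norm_of_nonneg ht.le]
      exact ht.ne'
    · refine HasDerivAt.comp_const_add r 0 ?_
      simpa using hU'
  -- Orthogonally to the ray the norm is `√(r² + t²)`, so each of the `n - 1` directions contributes
  -- `U'(r) / r`.
  have hoff : ∀ i, i ≠ i₀ → iteratedFDeriv ℝ 2 u (r • e)
      ![EuclideanSpace.single i (1 : ℝ), EuclideanSpace.single i (1 : ℝ)] = U' r / r := by
    intro i hi
    have hnorm : ∀ t : ℝ, ‖r • e + t • EuclideanSpace.single i (1 : ℝ)‖ = √(r ^ 2 + t ^ 2) := by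
      intro t
      have hin : inner ℝ (r • e) (t • EuclideanSpace.single i (1 : ℝ)) = 0 := by
        simp [he, inner_smul_left, inner_smul_right, EuclideanSpace.inner_single_left, hi.symm]
      rw [← sqrt_sq (norm_nonneg (r • e + _)), sq,
        norm_add_sq_eq_norm_sq_add_norm_sq_of_inner_eq_zero _ _ hin]
      congr 1
      simp [norm_smul, he, sq]
    have hpos : ∀ t : ℝ, 0 < r ^ 2 + t ^ 2 := fun t => by positivity
    have hs : ∀ t : ℝ, HasDerivAt (fun t => √(r ^ 2 + t ^ 2)) (t / √(r ^ 2 + t ^ 2)) t := fun t => by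
      have := (((hasDerivAt_id t).fun_pow 2).const_add (r ^ 2)).sqrt (hpos t).ne'
      refine this.congr_deriv ?_
      simp
      field_simp
    refine hu.iteratedFDeriv_two_eq_of_hasDerivAt
      (φ := fun t => U' √(r ^ 2 + t ^ 2) * (t / √(r ^ 2 + t ^ 2))) ?_ ?_
    · refine Eventually.of_forall fun t => ?_
      have h1 := (hU _ (sqrt_pos.2 (hpos t))).comp t (hs t)
      refine h1.congr_of_eventuallyEq (Eventually.of_forall fun t => ?_)
      simp only [Function.comp]
      rw [huU, hnorm]
      rw [← norm_ne_zero_iff, hnorm]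
      exact (sqrt_pos.2 (hpos t)).ne'
    · have h0 : √(r ^ 2 + (0 : ℝ) ^ 2) = r := by simp [sqrt_sq hr.le]
      have hA : HasDerivAt (fun t => U' √(r ^ 2 + t ^ 2)) (d * (0 / √(r ^ 2 + 0 ^ 2))) 0 :=
        HasDerivAt.comp (0 : ℝ) (by rw [h0]; exact hU') (hs 0)
      have hB := (hasDerivAt_id (0 : ℝ)).fun_div (hs 0) (by rw [h0]; exact hr.ne')
      refine (hA.fun_mul hB).congr_deriv ?_
      simp only [h0, id]
      field_simp
      ring
  rw [← Finset.add_sum_erase _ _ (Finset.mem_univ i₀), hdiag,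
    Finset.sum_congr rfl fun i hi => hoff i (Finset.ne_of_mem_erase hi)]
  simp [Finset.card_erase_of_mem, Nat.cast_sub (Fin.pos i₀)]

/-- The radial profile of a radially symmetric singular solution and the ODE it satisfies. -/
lemma IsSingularSolution.exists_radial_ode {n : ℕ} (i₀ : Fin n) {m α β : ℝ}
    {g : EuclideanSpace ℝ (Fin n) → ℝ} (hg : IsSingularSolution n m α β g) (hrad : IsRadial n g) :
    ∃ f f' f'' : ℝ → ℝ, (∀ x, x ≠ 0 → g x = f ‖x‖) ∧ (∀ r, 0 < r → 0 < f r) ∧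
      (∀ r, 0 < r → HasDerivAt f (f' r) r) ∧ (∀ r, 0 < r → HasDerivAt f' (f'' r) r) ∧
      ∀ r, 0 < r → m * (m - 1) * f r ^ (m - 2) * f' r ^ 2 + m * f r ^ (m - 1) * f'' r +
        (n - 1) * (m * f r ^ (m - 1) * f' r / r) + α * f r + β * (r * f' r) = 0 := by
  set e : EuclideanSpace ℝ (Fin n) := EuclideanSpace.single i₀ (1 : ℝ) with he
  have hne : ‖e‖ = 1 := by simp [he]
  have he0 : e ≠ 0 := norm_ne_zero_iff.1 (by rw [hne]; exact one_ne_zero)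
  set f : ℝ → ℝ := fun r => g (r • e) with hf
  have hre : ∀ r : ℝ, 0 < r → r • e ≠ 0 := fun r hr => smul_ne_zero hr.ne' he0
  have hgf : ∀ x, x ≠ 0 → g x = f ‖x‖ := fun x hx =>
    hrad _ _ hx (hre _ (norm_pos_iff.2 hx)) (by simp [norm_smul, hne])
  have hpos : ∀ r, 0 < r → 0 < f r := fun r hr => hg.pos _ (hre r hr)
  have hf2 : ContDiffOn ℝ 2 f (Ioi 0) :=
    hg.contDiffOn.comp (contDiff_id.smul contDiff_const).contDiffOn fun r hr => hre r hr
  have hd1 : ∀ r, 0 < r → HasDerivAt f (deriv f r) r := fun r hr =>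
    ((hf2.differentiableOn (by simp)).differentiableAt (Ioi_mem_nhds hr)).hasDerivAt
  have hd2 : ∀ r, 0 < r → HasDerivAt (deriv f) (deriv (deriv f) r) r := fun r hr =>
    (((hf2.deriv_of_isOpen (m := 1) isOpen_Ioi (by norm_num)).differentiableOn
      (by simp)).differentiableAt (Ioi_mem_nhds hr)).hasDerivAt
  refine ⟨f, deriv f, deriv (deriv f), hgf, hpos, hd1, hd2, fun r hr => ?_⟩
  have hgat : ContDiffAt ℝ 2 g (r • e) :=
    hg.contDiffOn.contDiffAt (isOpen_compl_singleton.mem_nhds (hre r hr))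
  have hgrad : inner ℝ (r • e) (gradient g (r • e)) = r * deriv f r := by
    have h1 : inner ℝ (gradient g (r • e)) (r • e) = fderiv ℝ g (r • e) (r • e) := by
      rw [← toDual_gradient, InnerProductSpace.toDual_apply_apply]
    have hl : HasDerivAt (fun r : ℝ => r • e) e r := by
      simpa using (hasDerivAt_id r).smul_const e
    have h2 : HasDerivAt f (fderiv ℝ g (r • e) e) r :=
      HasFDerivAt.comp_hasDerivAt (l := g) r (hgat.differentiableAt (by simp)).hasFDerivAt hl
    rw [real_inner_comm, h1, map_smul, h2.deriv, smul_eq_mul]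
  have hlap := laplacian_radial i₀ (u := fun x => g x ^ m) (U := fun r => f r ^ m)
    (U' := fun r => deriv f r * m * f r ^ (m - 1)) hr
    (hgat.rpow_const_of_ne (hpos r hr).ne') (fun x hx => by simp only [hgf x hx])
    (fun s hs => (hd1 s hs).rpow_const (Or.inl (hpos s hs).ne'))
    (((hd2 r hr).mul_const m).fun_mul
      ((hd1 r hr).rpow_const (p := m - 1) (Or.inl (hpos r hr).ne')))
  have heq := hg.eqn (r • e) (hre r hr)
  rw [hgrad, hlap] at heq
  rw [← heq, show m - 1 - 1 = m - 2 by ring]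
  change _ = _ + α * f r + β * (r * deriv f r)
  ring

/-! ### Logarithmic variables and the behaviour at the origin. -/

/-- In the conformal variables the radial ODE becomes an autonomous quadratic system. -/
lemma isLogProfile_of_radial_ode {N m α β C : ℝ} (hN : 0 < N) (hm : m = N / (N + 4))
    (hα : α = (2 * β + 1) / (1 - m)) (hC : C = N ^ 2 / (N + 4)) {f f' f'' : ℝ → ℝ}
    (hpos : ∀ r, 0 < r → 0 < f r) (hd1 : ∀ r, 0 < r → HasDerivAt f (f' r) r)
    (hd2 : ∀ r, 0 < r → HasDerivAt f' (f'' r) r)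
    (hode : ∀ r, 0 < r → m * (m - 1) * f r ^ (m - 2) * f' r ^ 2 + m * f r ^ (m - 1) * f'' r +
        (N + 1) * (m * f r ^ (m - 1) * f' r / r) + α * f r + β * (r * f' r) = 0) :
    IsLogProfile N (β * N) (fun s => 2 * s + (1 - m) * log (f (exp s)) - log C)
      (fun s => 2 + (1 - m) * (exp s * f' (exp s) / f (exp s))) := by
  have hdf : ∀ s, HasDerivAt (fun s => f (exp s)) (f' (exp s) * exp s) s := fun s =>
    (hd1 _ (exp_pos s)).comp s (Real.hasDerivAt_exp s)
  have hdf' : ∀ s, HasDerivAt (fun s => f' (exp s)) (f'' (exp s) * exp s) s := fun s =>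
    (hd2 _ (exp_pos s)).comp s (Real.hasDerivAt_exp s)
  have hCpos : 0 < C := by rw [hC]; positivity
  refine ⟨fun s => ?_, fun s => ?_⟩
  · have h1 := (hdf s).log (hpos _ (exp_pos s)).ne'
    refine ((((hasDerivAt_id s).const_mul 2).fun_add
      (h1.const_mul (1 - m))).sub_const _).congr_deriv ?_
    ring
  · have h1 := (((((Real.hasDerivAt_exp s).fun_mul (hdf' s)).fun_div (hdf s)
      (hpos _ (exp_pos s)).ne').const_mul (1 - m)).const_add 2)
    refine h1.congr_deriv ?_
    have hf := hpos _ (exp_pos s)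
    have ho := hode _ (exp_pos s)
    have hr := exp_pos s
    have hX : exp (2 * s + (1 - m) * log (f (exp s)) - log C) =
        exp s ^ 2 / (f (exp s) ^ (m - 1) * C) := by
      rw [exp_sub, exp_log hCpos, exp_add, ← exp_nat_mul, rpow_def_of_pos hf,
        show (1 - m) * log (f (exp s)) = -(log (f (exp s)) * (m - 1)) by ring, exp_neg]
      field_simp
      norm_num
      ring
    have hp2 : f (exp s) ^ (m - 2) = f (exp s) ^ (m - 1) / f (exp s) := by
      rw [← rpow_sub_one hf.ne']; ring_nf
    rw [hX]
    rw [hp2] at ho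
    have hp : 0 < f (exp s) ^ (m - 1) := rpow_pos_of_pos hf _
    -- All powers of `f` are now expressed by `p` and `u`, so with free variables the claim is a
    -- rational identity.
    generalize f (exp s) ^ (m - 1) = p at *
    generalize f (exp s) = u at *
    generalize f' (exp s) = u' at *
    generalize f'' (exp s) = u'' at *
    generalize exp s = r at *
    have h1m : 1 - m = 4 / (N + 4) := by rw [hm]; field_simp; ring
    have hu : u'' = -(m * (m - 1) * (p / u) * u' ^ 2 + (N + 1) * (m * p * u' / r) + α * u +
        β * (r * u')) / (m * p) := by
      have : 0 < m := by rw [hm]; positivity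
      field_simp at ho ⊢
      linarith
    rw [hu, hα, hC, h1m, hm]
    field_simp
    ring

/-- The blow-up rate at the origin in logarithmic variables. -/
lemma tendsto_log_profile_atBot {m α β C K : ℝ} (hβ : β ≠ 0) (hm : 1 - m ≠ 0) (hK : 0 < K)
    (hα : α = (2 * β + 1) / (1 - m)) {f : ℝ → ℝ} (hpos : ∀ r, 0 < r → 0 < f r)
    (hf : Tendsto (fun r => r ^ (α / β) * f r) (𝓝[>] 0) (𝓝 K)) :
    Tendsto (fun s => 2 * s + (1 - m) * log (f (exp s)) - log C + 1 / β * s) atBot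
      (𝓝 ((1 - m) * log K - log C)) := by
  have h0 : Tendsto exp atBot (𝓝[>] 0) := tendsto_exp_atBot_nhdsGT
  refine ((((hf.comp h0).log hK.ne').const_mul (1 - m)).sub_const (log C)).congr fun s => ?_
  simp only [Function.comp]
  -- The slopes match because `(1 - m) α / β = 2 + 1 / β`.
  rw [log_mul (rpow_pos_of_pos (exp_pos s) _).ne' (hpos _ (exp_pos s)).ne',
    log_rpow (exp_pos s), log_exp, hα]
  field_simp
  ring

/-! ### Characteristic roots and the final expansion. -/

/-- If `T → 0` and `D / T → b`, then `(1 + D)^c = 1 + c b T + o(T)`. -/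
lemma rpow_one_add_isLittleO {ι : Type*} {l : Filter ι} {D T : ι → ℝ} {b : ℝ} (c : ℝ)
    (hT : Tendsto T l (𝓝 0)) (hD : (fun i => D i - b * T i) =o[l] T) :
    (fun i => (1 + D i) ^ c - 1 - c * b * T i) =o[l] T := by
  have hDO : D =O[l] T := by
    simpa using hD.isBigO.add ((isBigO_refl T l).const_mul_left b)
  have hD0 : Tendsto D l (𝓝 0) := hDO.trans_tendsto hT
  have hder : HasDerivAt (fun x : ℝ => (1 + x) ^ c) c 0 := by
    have := ((hasDerivAt_id (0 : ℝ)).const_add 1).rpow_const (p := c) (Or.inl (by simp))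
    simpa using this
  have h1 := (hasDerivAt_iff_isLittleO_nhds_zero.1 hder).comp_tendsto hD0
  have h2 : (fun i => (1 + D i) ^ c - 1 - D i * c) =o[l] D := by
    simpa [Function.comp_def] using h1
  refine ((h2.trans_isBigO hDO).add (hD.const_mul_left c)).congr_left fun i => ?_
  ring

/-- The two roots of `γ² - β(n-2)γ + (n-2) = 0` are separated by `2`. -/
lemma gammaOne_spec {n : ℕ} (hn : 3 ≤ n) {m β : ℝ} (hm : m = ((n : ℝ) - 2) / ((n : ℝ) + 2))
    (hβ : betaOne n m 1 < β) :
    0 < gammaOne n m 1 β ∧ gammaOne n m 1 β < 2 ∧ ∃ γ', 2 < γ' ∧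
      gammaOne n m 1 β + γ' = β * (n - 2) ∧ gammaOne n m 1 β * γ' = n - 2 := by
  have hn' : (3 : ℝ) ≤ n := by exact_mod_cast hn
  set N : ℝ := n - 2 with hN
  have hnN : (n : ℝ) = N + 2 := by rw [hN]; ring
  have hNpos : 0 < N := by linarith
  have hm' : m = N / (N + 4) := by rw [hm, hnN]; ring_nf
  have hA : coeffA n m 1 β = 4 * β * N / (N + 4) := by
    rw [coeffA, hnN, hm']; field_simp; ring
  have hb : N + 4 < 2 * (β * N) := by
    rw [betaOne, hnN, hm', div_lt_iff₀ (by rw [sub_pos]; field_simp; nlinarith)] at hβ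
    field_simp at hβ
    nlinarith
  have h1m : 1 - m = 4 / (N + 4) := by rw [hm']; field_simp; ring
  have hdisc : coeffA n m 1 β ^ 2 - 8 * ((n : ℝ) - 2 - n * m) * (1 - m) =
      16 / (N + 4) ^ 2 * ((β * N) ^ 2 - 4 * N) := by
    rw [hA, h1m, hnN, hm']; field_simp; ring
  -- From `hb`, `(β N)² > (N + 4)² / 4 ≥ 4 N`.
  have hΔ : 0 ≤ (β * N) ^ 2 - 4 * N := by nlinarith [sq_nonneg (N - 4)]
  have hsq : √(16 / (N + 4) ^ 2 * ((β * N) ^ 2 - 4 * N)) =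
      4 / (N + 4) * √((β * N) ^ 2 - 4 * N) := by
    rw [sqrt_mul (by positivity), show (16 : ℝ) / (N + 4) ^ 2 = (4 / (N + 4)) ^ 2 by
      rw [div_pow]; norm_num,
      sqrt_sq (by positivity)]
  have hγ : gammaOne n m 1 β = (β * N - √((β * N) ^ 2 - 4 * N)) / 2 := by
    rw [gammaOne, hdisc, hsq, hA, h1m]; field_simp
  set S := √((β * N) ^ 2 - 4 * N) with hS
  have hS2 : S ^ 2 = (β * N) ^ 2 - 4 * N := sq_sqrt hΔ
  have hS0 : 0 ≤ S := sqrt_nonneg _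
  rw [hγ]
  -- Equivalent to `hb`; `|β N - 4| < S` puts `2` strictly between the roots `(β N ± S) / 2`.
  have h4 : (β * N - 4) ^ 2 < S ^ 2 := by rw [hS2]; linarith
  have h5 := abs_lt_of_sq_lt_sq' h4 hS0
  have h6 : S < β * N := lt_of_pow_lt_pow_left₀ 2 (by linarith) (by rw [hS2]; linarith)
  refine ⟨by linarith, by linarith [h5.2], (β * N + S) / 2, by linarith [h5.1], by ring, ?_⟩
  linear_combination (-1 / 4) * hS2

theorem theorem4p1 (n : ℕ) (hn : 3 ≤ n) (m ρ₁ lam α β : ℝ)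
    (hm : m = ((n : ℝ) - 2) / ((n : ℝ) + 2)) (hρ : ρ₁ = 1) (hlam : 0 < lam)
    (hβ : betaOne n m ρ₁ < β) (hα : α = (2 * β + 1) / (1 - m))
    (g : EuclideanSpace ℝ (Fin n) → ℝ)
    (hg : IsSingularSolution n m α β g) (hrad : IsRadial n g)
    (hblow : HasBlowUpRate n m ρ₁ α β lam g) :
    ∃ B : ℝ, 0 < B ∧ ∃ ε : EuclideanSpace ℝ (Fin n) → ℝ,
      ε =o[Bornology.cobounded (EuclideanSpace ℝ (Fin n))]
        (fun x => ‖x‖ ^ (-gammaOne n m ρ₁ β)) ∧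
      ∀ x, x ≠ 0 →
        g x = (cStar n m ρ₁ / ‖x‖ ^ 2) ^ (1 / (1 - m)) *
          (1 + B * ‖x‖ ^ (-gammaOne n m ρ₁ β) + ε x) := by
  subst hρ
  obtain ⟨hγ, hγ2, γ', hγ', hsum, hprod⟩ := gammaOne_spec hn hm hβ
  set γ := gammaOne n m 1 β
  have hn' : (3 : ℝ) ≤ n := by exact_mod_cast hn
  have hNpos : (0 : ℝ) < n - 2 := by linarith
  have hm' : m = ((n : ℝ) - 2) / ((n : ℝ) - 2 + 4) := by rw [hm]; ring_nf
  have h1m : 1 - m = 4 / ((n : ℝ) - 2 + 4) := by rw [hm']; field_simp; ring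
  have h1m0 : 0 < 1 - m := by rw [h1m]; positivity
  have hC : cStar n m 1 = ((n : ℝ) - 2) ^ 2 / ((n : ℝ) - 2 + 4) := by
    rw [cStar, h1m, hm']; field_simp; ring
  have hCpos : 0 < cStar n m 1 := by rw [hC]; positivity
  have hβ0 : 0 < β := pos_of_mul_pos_left (by linarith : 0 < β * ((n : ℝ) - 2)) hNpos.le
  obtain ⟨f, f', f'', hgf, hpos, hd1, hd2, hode⟩ :=
    hg.exists_radial_ode ⟨0, by omega⟩ hrad
  have hprofile := isLogProfile_of_radial_ode hNpos hm' hα hC hpos hd1 hd2 (by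
    convert hode using 6; ring)
  have hK : 0 < lam ^ (-1 / ((1 - m) * β)) := rpow_pos_of_pos hlam _
  have hray : Tendsto (fun r : ℝ => r • (EuclideanSpace.single ⟨0, by omega⟩ (1 : ℝ) :
      EuclideanSpace ℝ (Fin n))) (𝓝[>] 0) (𝓝[≠] 0) := by
    refine tendsto_nhdsWithin_iff.2 ⟨?_, ?_⟩
    · have hcont : Continuous fun r : ℝ => r • (EuclideanSpace.single ⟨0, by omega⟩ (1 : ℝ) :
          EuclideanSpace ℝ (Fin n)) := continuous_id.smul continuous_const
      exact (hcont.tendsto' 0 0 (zero_smul ℝ (_ : EuclideanSpace ℝ (Fin n)))).mono_left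
        nhdsWithin_le_nhds
    · filter_upwards [self_mem_nhdsWithin] with r hr
      simpa using (mem_Ioi.1 hr).ne'
  have hf0 : Tendsto (fun r => r ^ (α / β) * f r) (𝓝[>] 0)
      (𝓝 (lam ^ (-1 / ((1 - m) * β)))) := by
    refine (hblow.comp hray).congr' ?_
    filter_upwards [self_mem_nhdsWithin] with r hr
    have hr : 0 < r := hr
    simp only [Function.comp]
    rw [hgf _ (by simpa using hr.ne')]
    simp [norm_smul, abs_of_pos hr]
  obtain ⟨B, hB, hlim⟩ := hprofile.exists_tendsto hγ hγ2 hγ' hsum hprod (one_div_pos.2 hβ0)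
    (tendsto_log_profile_atBot hβ0.ne' h1m0.ne' hK hα hpos hf0)
  set q : ℝ → ℝ := fun s => 2 * s + (1 - m) * log (f (exp s)) - log (cStar n m 1) with hq
  have hTpos : ∀ r : ℝ, 0 < r → r ^ (-γ) = (exp (γ * log r))⁻¹ := fun r hr => by
    rw [rpow_def_of_pos hr, ← exp_neg]; ring_nf
  have hT : Tendsto (fun r : ℝ => r ^ (-γ)) atTop (𝓝 0) := tendsto_rpow_neg_atTop hγ
  have hD : (fun r => (exp (q (log r)) - 1) - B * r ^ (-γ)) =o[atTop]
      fun r : ℝ => r ^ (-γ) := by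
    rw [isLittleO_iff_tendsto' (by
      filter_upwards [eventually_gt_atTop 0] with r hr h
      exact absurd h (rpow_pos_of_pos hr _).ne')]
    have h1 := (hlim.comp tendsto_log_atTop).sub_const B
    rw [sub_self] at h1
    refine h1.congr' ?_
    filter_upwards [eventually_gt_atTop 0] with r hr
    rw [hTpos r hr]
    change exp (γ * log r) * (exp (q (log r)) - 1) - B = _
    field_simp
  have hmain := rpow_one_add_isLittleO (1 / (1 - m)) hT hD
  -- The factor `1/(1-m)` comes from linearizing `X^(1/(1-m))` at `X = 1`; `ε` is the exact
  -- remainder, so the identity holds for every `x ≠ 0`.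
  refine ⟨1 / (1 - m) * B, by positivity, _,
    hmain.comp_tendsto tendsto_norm_cobounded_atTop, fun x hx => ?_⟩
  have hr : 0 < ‖x‖ := norm_pos_iff.2 hx
  have hfr := hpos _ hr
  simp only [Function.comp]
  rw [show ∀ a b : ℝ, 1 + b + (a - 1 - b) = a by intros; ring, hgf x hx, add_sub_cancel,
    ← mul_rpow (by positivity) (exp_pos _).le]
  have hX : exp (q (log ‖x‖)) = ‖x‖ ^ 2 * f ‖x‖ ^ (1 - m) / cStar n m 1 := by
    simp only [hq]
    rw [exp_log hr, exp_sub, exp_log hCpos, exp_add, rpow_def_of_pos hfr,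
      show 2 * log ‖x‖ = log ‖x‖ + log ‖x‖ by ring, exp_add, exp_log hr]
    ring_nf
  rw [hX, show cStar n m 1 / ‖x‖ ^ 2 * (‖x‖ ^ 2 * f ‖x‖ ^ (1 - m) / cStar n m 1) =
    f ‖x‖ ^ (1 - m) by field_simp, ← rpow_mul hfr.le, mul_one_div_cancel h1m0.ne', rpow_one]
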